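/- Let $n \ge 2$ be an integer, let $G = \mathfrak S_{n+1}$, and let $\lambda = (2,1^{n-1})$, a partition of $n+1$. Let $L^{\lambda} = \bigoplus_T \mathbf Z e_T$ be the Specht lattice, the $\mathbf Z$-span of the Specht basis, where $T$ runs over the standard Young tableaux of shape $\lambda$ and the polytabloid $e_T = \sum_{g} \operatorname{sgn}(g)\,\{gT\}$ is the signed sum, over the column stabilizer of $T$, of the tabloids $\{gT\}$ (the row equivalence classes of the tableaux $gT$). It is a $\mathbf ZG$-submodule of the permutation module on the tabloids of shape $\lambda$. Let \[ \zeta_{\mathbf ZG}(L^\lambda,s) = \sum_{N} |L^\lambda : N|^{-s} \] be its Solomon zeta function, where $N$ runs over the $\mathbf ZG$-submodules of finite index in $L^\lambda$. Then for every $s \in \mathbf C$ with $\operatorname{Re}(s) > 1/n$ this series converges absolutely and \[ \zeta_{\mathbf ZG}(L^{\lambda},s) = \zeta_{\mathbf Q}(ns) \prod_{p \mid n+1} \varphi_p(p^{-s}), \qquad \varphi_p = \frac{X^{v_p(n+1)+1} - 1}{X - 1} = 1 + X + \dots + X^{v_p(n+1)}, \] where $p$ runs over the prime divisors of $n+1$,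 $v_p$ is the $p$-adic valuation, and $\zeta_{\mathbf Q}$ is the Riemann zeta function. -/

import Mathlib

open scoped MonoidAlgebra

noncomputable section

/-! ### Solomon zeta functions -/

/-- The `Λ`-sublattices of finite index in a `Λ`-lattice `M`. -/
abbrev FiniteIndexSublattice (Λ M : Type*) [Ring Λ] [AddCommGroup M] [Module Λ M] : Type _ :=
  {N : Submodule Λ M // N.toAddSubgroup.FiniteIndex}

/-- The summand `|M : N| ^ (-s)` of the Solomon zeta function. -/
def solomonTerm {Λ M : Type*} [Ring Λ] [AddCommGroup M] [Module Λ M] (s : ℂ)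
    (N : FiniteIndexSublattice Λ M) : ℂ :=
  (N.1.toAddSubgroup.index : ℂ) ^ (-s)

/-- The Solomon zeta function `ζ_Λ(M, s)`: the sum of `|M : N| ^ (-s)` over all `Λ`-sublattices `N`
of finite index in `M`. -/
def solomonZeta (Λ M : Type*) [Ring Λ] [AddCommGroup M] [Module Λ M] (s : ℂ) : ℂ :=
  ∑' N : FiniteIndexSublattice Λ M, solomonTerm s N

/-! ### Tableaux, tabloids and polytabloids -/

/-- A tableau of shape `μ`: a filling of the cells of `μ` with the elements of `Fin m`, each used
exactly once. There are none unless `μ` has `m` cells. -/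
abbrev YTableau (μ : YoungDiagram) (m : ℕ) : Type := μ.cells ≃ Fin m

namespace YTableau

variable {μ : YoungDiagram} {m : ℕ}

/-- The row in which `x` stands. -/
def rowOf (T : YTableau μ m) (x : Fin m) : ℕ := (T.symm x).1.1

/-- The column in which `x` stands. -/
def colOf (T : YTableau μ m) (x : Fin m) : ℕ := (T.symm x).1.2

/-- `gT`: apply the permutation `g` to every entry of `T`. -/
def act (g : Equiv.Perm (Fin m)) (T : YTableau μ m) : YTableau μ m := T.trans g

/-- `T` is standard: its entries increase along each row and down each column. -/
def IsStandard (T : YTableau μ m) : Prop :=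
  ∀ c c' : μ.cells, (c.1.1 = c'.1.1 ∧ c.1.2 < c'.1.2) ∨ (c.1.2 = c'.1.2 ∧ c.1.1 < c'.1.1) →
    T c < T c'

/-- Row equivalence of tableaux: every number stands in the same row of both. -/
def rowSetoid (μ : YoungDiagram) (m : ℕ) : Setoid (YTableau μ m) := Setoid.ker rowOf

@[simp] lemma rowOf_act (g : Equiv.Perm (Fin m)) (T : YTableau μ m) (x : Fin m) :
    (act g T).rowOf x = T.rowOf (g⁻¹ x) := rfl

@[simp] lemma colOf_act (g : Equiv.Perm (Fin m)) (T : YTableau μ m) (x : Fin m) :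
    (act g T).colOf x = T.colOf (g⁻¹ x) := rfl

lemma act_one (T : YTableau μ m) : act 1 T = T := rfl

lemma act_mul (g h : Equiv.Perm (Fin m)) (T : YTableau μ m) : act (g * h) T = act g (act h T) := rfl

end YTableau

/-- A tabloid of shape `μ`: a row equivalence class of tableaux. -/
def Tabloid (μ : YoungDiagram) (m : ℕ) : Type := Quotient (YTableau.rowSetoid μ m)

namespace Tabloid

variable {μ : YoungDiagram} {m : ℕ}

/-- The tabloid `{T}` of the tableau `T`. -/
def mk (T : YTableau μ m) : Tabloid μ m := Quotient.mk (YTableau.rowSetoid μ m) T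

lemma mk_eq_mk {T T' : YTableau μ m} : mk T = mk T' ↔ ∀ x, T.rowOf x = T'.rowOf x := by
  exact Quotient.eq.trans funext_iff

/-- `g{T} = {gT}`. -/
instance : MulAction (Equiv.Perm (Fin m)) (Tabloid μ m) where
  smul g := Quotient.lift (fun T => mk (YTableau.act g T)) fun T T' h => by
    have h' : ∀ x, T.rowOf x = T'.rowOf x := fun x => congrFun h x
    exact mk_eq_mk.2 fun x => h' _
  one_smul t := by
    induction t using Quotient.inductionOn
    rfl
  mul_smul g h t := by
    induction t using Quotient.inductionOn
    rfl

lemma smul_mk (g : Equiv.Perm (Fin m)) (T : YTableau μ m) :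
    g • mk T = mk (YTableau.act g T) := rfl

end Tabloid

/-- The permutation representation of the symmetric group on the free `ℤ`-module on the tabloids
of shape `μ`. -/
abbrev tabloidRep (μ : YoungDiagram) (m : ℕ) :
    Representation ℤ (Equiv.Perm (Fin m)) ℤ[Tabloid μ m] :=
  Representation.ofMulAction ℤ (Equiv.Perm (Fin m)) (Tabloid μ m)

/-- The column stabilizer of `T`. -/
def YTableau.colStab {μ : YoungDiagram} {m : ℕ} (T : YTableau μ m) :
    Finset (Equiv.Perm (Fin m)) :=
  Finset.univ.filter fun g => ∀ x, T.colOf (g x) = T.colOf x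

lemma YTableau.mem_colStab {μ : YoungDiagram} {m : ℕ} {T : YTableau μ m}
    {g : Equiv.Perm (Fin m)} : g ∈ T.colStab ↔ ∀ x, T.colOf (g x) = T.colOf x := by
  simp [colStab]

/-- The polytabloid `e_T`, the signed sum of `{gT}` over the column stabilizer of `T`. -/
def polytabloid {μ : YoungDiagram} {m : ℕ} (T : YTableau μ m) : ℤ[Tabloid μ m] :=
  ∑ g ∈ T.colStab, MonoidAlgebra.single (Tabloid.mk (T.act g)) ((Equiv.Perm.sign g : ℤˣ) : ℤ)

/-- The `ℤ`-span of the Specht basis, i.e. of the `e_T` for the standard tableaux `T` of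
shape `μ`. -/
def standardSpan (μ : YoungDiagram) (m : ℕ) : Submodule ℤ ℤ[Tabloid μ m] :=
  Submodule.span ℤ {e | ∃ T : YTableau μ m, T.IsStandard ∧ e = polytabloid T}

/-! ### General facts on polytabloids -/

section Polytabloid

variable {μ : YoungDiagram} {m : ℕ}

open YTableau Equiv.Perm

lemma tabloidRep_polytabloid (h : Equiv.Perm (Fin m)) (T : YTableau μ m) :
    tabloidRep μ m h (polytabloid T) = polytabloid (act h T) := by
  unfold polytabloid
  rw [map_sum]
  refine Finset.sum_bij' (fun g _ => h * g * h⁻¹) (fun g _ => h⁻¹ * g * h) ?_ ?_ ?_ ?_ ?_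
  · intro g hg
    rw [mem_colStab] at hg ⊢
    simp only [colOf_act] at hg ⊢
    intro x
    simpa using hg (h⁻¹ x)
  · intro g hg
    rw [mem_colStab] at hg ⊢
    simp only [colOf_act] at hg ⊢
    intro x
    simpa using hg (h x)
  · intro g _; group
  · intro g _; group
  · intro g _
    rw [Representation.ofMulAction_single, Tabloid.smul_mk, ← act_mul, ← act_mul]
    rcases Int.units_eq_one_or (sign h) with h1 | h1 <;> simp [h1]

lemma polytabloid_act_of_mem {h : Equiv.Perm (Fin m)} {T : YTableau μ m} (hh : h ∈ T.colStab) :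
    polytabloid (act h T) = ((sign h : ℤˣ) : ℤ) • polytabloid T := by
  have hh' : ∀ x, T.colOf (h x) = T.colOf x := mem_colStab.1 hh
  have hinv : ∀ x, T.colOf (h⁻¹ x) = T.colOf x := fun x => by simpa using (hh' (h⁻¹ x)).symm
  unfold polytabloid
  rw [Finset.smul_sum]
  refine Finset.sum_bij' (fun g _ => g * h) (fun g _ => g * h⁻¹) ?_ ?_ ?_ ?_ ?_
  · intro g hg
    rw [mem_colStab] at hg ⊢
    simp only [colOf_act, hinv] at hg ⊢
    intro x
    simp [hg, hh']
  · intro g hg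
    rw [mem_colStab] at hg ⊢
    simp only [colOf_act, hinv] at hg ⊢
    intro x
    rw [Equiv.Perm.mul_apply, hg, hinv]
  · intro g _; group
  · intro g _; group
  · intro g _
    rw [act_mul, MonoidAlgebra.smul_single]
    congr 1
    rcases Int.units_eq_one_or (sign h) with h1 | h1 <;> simp [h1]

end Polytabloid

/-! ### The hook `(2, 1^(n-1))` -/

/-- The partition `(2, 1, …, 1)` with `n - 1` ones, as a Young diagram. -/
def hook (n : ℕ) : YoungDiagram :=
  YoungDiagram.ofRowLens (2 :: List.replicate (n - 1) 1) (by
    rw [List.sortedGE_iff_pairwise]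
    simp [List.pairwise_replicate])

section Hook

open YTableau Equiv.Perm

lemma mem_hook {n : ℕ} (hn : 2 ≤ n) {c : ℕ × ℕ} :
    c ∈ (hook n).cells ↔ c = (0, 1) ∨ (c.1 < n ∧ c.2 = 0) := by
  obtain ⟨i, j⟩ := c
  rw [YoungDiagram.mem_cells, hook, YoungDiagram.mem_ofRowLens]
  rcases i with _ | i
  · simp
    omega
  · simp
    omega

/-- The cell at the end of the first row. -/
def hookArm {n : ℕ} (hn : 2 ≤ n) : (hook n).cells := ⟨(0, 1), (mem_hook hn).2 (Or.inl rfl)⟩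

lemma colOf_hook {n : ℕ} (hn : 2 ≤ n) (T : YTableau (hook n) (n + 1)) (x : Fin (n + 1)) :
    T.colOf x = if x = T (hookArm hn) then 1 else 0 := by
  split_ifs with h
  · subst h; simp [colOf, hookArm]
  · have hx := (mem_hook hn).1 (T.symm x).2
    rcases hx with hx | hx
    · exact absurd (by rw [← T.apply_symm_apply x]; congr 1; exact Subtype.ext hx) h
    · exact hx.2

lemma mem_colStab_hook {n : ℕ} (hn : 2 ≤ n) (T : YTableau (hook n) (n + 1))
    (g : Equiv.Perm (Fin (n + 1))) :
    g ∈ T.colStab ↔ g (T (hookArm hn)) = T (hookArm hn) := by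
  simp only [colStab, Finset.mem_filter, Finset.mem_univ, true_and, colOf_hook hn]
  constructor
  · intro h
    by_contra h'
    simpa [h'] using h (T (hookArm hn))
  · intro h x
    have : g x = T (hookArm hn) ↔ x = T (hookArm hn) := by
      conv_lhs => rw [← h]
      exact g.injective.eq_iff
    simp [this]

/-- A tableau whose arm entry is not the least number equals a standard one up to a column
permutation. -/
lemma exists_standard {n : ℕ} (hn : 2 ≤ n) (T : YTableau (hook n) (n + 1))
    (hb : T (hookArm hn) ≠ 0) :
    ∃ S : YTableau (hook n) (n + 1), S.IsStandard ∧ S (hookArm hn) = T (hookArm hn) := by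
  classical
  set b := T (hookArm hn) with hbdef
  have key : ∀ c : (hook n).cells, c.1.2 ≠ 0 → c = hookArm hn := by
    intro c hc
    rcases (mem_hook hn).1 c.2 with h | h
    · exact Subtype.ext h
    · exact absurd h.2 hc
  have lt : ∀ c : (hook n).cells, c.1.1 < n := by
    intro c
    rcases (mem_hook hn).1 c.2 with h | h
    · rw [h]; exact (by omega : 0 < n)
    · exact h.1
  let f : (hook n).cells → Fin (n + 1) := fun c =>
    if c.1.2 = 0 then b.succAbove ⟨c.1.1, lt c⟩ else b
  have hinj : Function.Injective f := by
    intro c c' h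
    simp only [f] at h
    split_ifs at h with h1 h2 h2
    · have := congrArg Fin.val (Fin.succAbove_right_injective h)
      exact Subtype.ext (Prod.ext this (h1.trans h2.symm))
    · exact absurd h (Fin.succAbove_ne _ _)
    · exact absurd h.symm (Fin.succAbove_ne _ _)
    · rw [key c h1, key c' h2]
  have hbij : Function.Bijective f :=
    (Fintype.bijective_iff_injective_and_card f).2 ⟨hinj, Fintype.card_congr T⟩
  refine ⟨Equiv.ofBijective f hbij, ?_, ?_⟩
  · intro c c' h
    simp only [Equiv.ofBijective_apply, f]
    rcases h with ⟨hr, hc⟩ | ⟨hc, hr⟩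
    · have h' : c'.1.2 ≠ 0 := by omega
      have h0 := key c' h'
      subst h0
      have h1 : c.1.2 = 0 := by simp only [hookArm] at hc; omega
      have h2 : c.1.1 = 0 := by simpa [hookArm] using hr
      rw [if_pos h1, if_neg h']
      refine (Fin.succAbove_lt_iff_castSucc_lt _ _).2 ?_
      rw [Fin.lt_def]
      simp only [Fin.val_castSucc, h2]
      exact Nat.pos_of_ne_zero fun h => hb (Fin.ext h)
    · by_cases h1 : c.1.2 = 0
      · rw [if_pos h1, if_pos (hc ▸ h1)]
        exact Fin.strictMono_succAbove b (Fin.mk_lt_mk.2 hr)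
      · have h2 : c'.1.2 ≠ 0 := by omega
        rw [key c h1, key c' h2] at hr
        exact absurd hr (lt_irrefl _)
  · simp [f, hookArm]

lemma polytabloid_mem_of_ne {n : ℕ} (hn : 2 ≤ n) (T : YTableau (hook n) (n + 1))
    (hb : T (hookArm hn) ≠ 0) : polytabloid T ∈ standardSpan (hook n) (n + 1) := by
  obtain ⟨S, hS, hST⟩ := exists_standard hn T hb
  have hT : T = act (S.symm.trans T) S := by
    ext c; simp [act]
  rw [hT, polytabloid_act_of_mem]
  · exact Submodule.smul_mem _ _ (Submodule.subset_span ⟨S, hS, rfl⟩)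
  · rw [mem_colStab_hook hn]
    simp [← hST]

/-- The linear relation between the polytabloids with different arm entries. -/
lemma sum_polytabloid_eq_zero {n : ℕ} (hn : 2 ≤ n) (T : YTableau (hook n) (n + 1)) :
    ∑ c : Fin (n + 1), ((sign (Equiv.swap (T (hookArm hn)) c) : ℤˣ) : ℤ) •
      polytabloid (act (Equiv.swap (T (hookArm hn)) c) T) = 0 := by
  classical
  set b := T (hookArm hn) with hb
  let F : Equiv.Perm (Fin (n + 1)) → ℤ[Tabloid (hook n) (n + 1)] := fun g =>
    MonoidAlgebra.single (Tabloid.mk (T.act g)) ((sign g : ℤˣ) : ℤ)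
  let c0 : (hook n).cells := ⟨(0, 0), (mem_hook hn).2 (Or.inr ⟨by simp; omega, rfl⟩)⟩
  have hne : T c0 ≠ b := by
    rw [hb, Ne, T.injective.eq_iff]
    intro h
    simpa [c0, hookArm] using congrArg (fun c => c.1.2) h
  -- The total signed sum vanishes: the two entries of the first row may be exchanged.
  have hzero : ∑ g, F g = 0 := by
    refine Finset.sum_involution (fun g _ => g * Equiv.swap (T c0) b) ?_ ?_ ?_ ?_
    · intro g _
      have : Tabloid.mk (T.act (g * Equiv.swap (T c0) b)) = Tabloid.mk (T.act g) := by
        rw [Tabloid.mk_eq_mk]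
        intro x
        simp only [rowOf_act, mul_inv_rev, Equiv.swap_inv, Equiv.Perm.mul_apply]
        generalize g⁻¹ x = y
        rcases eq_or_ne y (T c0) with rfl | h1
        · rw [Equiv.swap_apply_left]; simp [rowOf, hb, c0, hookArm]
        rcases eq_or_ne y b with rfl | h2
        · rw [Equiv.swap_apply_right]; simp [rowOf, hb, c0, hookArm]
        rw [Equiv.swap_apply_of_ne_of_ne h1 h2]
      simp only [F, this]
      rw [← MonoidAlgebra.single_add]
      simp [sign_swap hne]
    · intro g _ _ h
      have : Equiv.swap (T c0) b = 1 := by simpa using h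
      exact hne (Equiv.swap_eq_one_iff.1 this)
    · intro g _; exact Finset.mem_univ _
    · intro g _; simp [mul_assoc]
  -- Sort the total sum by the image of the arm entry.
  rw [← Finset.sum_fiberwise (s := Finset.univ) (g := fun g : Equiv.Perm (Fin (n + 1)) => g b)
    (f := F)] at hzero
  rw [← hzero]
  refine Finset.sum_congr rfl fun c _ => ?_
  unfold polytabloid
  rw [Finset.smul_sum]
  have harm : act (Equiv.swap b c) T (hookArm hn) = c := by
    simp [act, ← hb]
  refine Finset.sum_bij' (fun g _ => g * Equiv.swap b c) (fun g _ => g * Equiv.swap b c)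
    ?_ ?_ ?_ ?_ ?_
  · intro g hg
    rw [mem_colStab_hook hn, harm] at hg
    simp [hg]
  · intro g hg
    rw [mem_colStab_hook hn, harm]
    simpa using hg
  · intro g _; simp [mul_assoc]
  · intro g _; simp [mul_assoc]
  · intro g _
    simp only [F]
    rw [act_mul, MonoidAlgebra.smul_single]
    congr 1
    rw [Equiv.Perm.sign_mul, Units.val_mul, smul_eq_mul, mul_comm]

lemma polytabloid_mem {n : ℕ} (hn : 2 ≤ n) (T : YTableau (hook n) (n + 1)) :
    polytabloid T ∈ standardSpan (hook n) (n + 1) := by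
  classical
  by_cases hb : T (hookArm hn) = 0
  · have h := sum_polytabloid_eq_zero hn T
    rw [← Finset.add_sum_erase _ _ (Finset.mem_univ (T (hookArm hn)))] at h
    have hT : polytabloid T = -∑ c ∈ Finset.univ.erase (T (hookArm hn)),
        ((sign (Equiv.swap (T (hookArm hn)) c) : ℤˣ) : ℤ) •
          polytabloid (act (Equiv.swap (T (hookArm hn)) c) T) := by
      rw [← add_eq_zero_iff_eq_neg, ← h]
      congr 1
      simp [← Equiv.Perm.one_def, act_one]
    rw [hT]
    refine Submodule.neg_mem _ (Submodule.sum_mem _ fun c hc => Submodule.smul_mem _ _ ?_)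
    refine polytabloid_mem_of_ne hn _ ?_
    rw [hb] at hc
    simpa [act] using (Finset.ne_of_mem_erase hc)
  · exact polytabloid_mem_of_ne hn T hb

/-- The Specht lattice `L^(2, 1^(n-1))`, the `ℤ`-span of the Specht basis, as a subrepresentation
over `ℤ` of the module on tabloids. -/
def spechtSubrep (n : ℕ) (hn : 2 ≤ n) : Subrepresentation (tabloidRep (hook n) (n + 1)) where
  toSubmodule := standardSpan (hook n) (n + 1)
  apply_mem_toSubmodule g v hv := by
    induction hv using Submodule.span_induction with
    | mem x hx =>
      obtain ⟨T, -, rfl⟩ := hx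
      rw [tabloidRep_polytabloid]
      exact polytabloid_mem hn _
    | zero => simp
    | add x y _ _ hx hy => rw [map_add]; exact Submodule.add_mem _ hx hy
    | smul a x _ hx => rw [map_smul]; exact Submodule.smul_mem _ _ hx

end Hook

/-- The Specht lattice `L^(2, 1^(n-1))` as a module over the group ring `ℤ[S_(n+1)]`. -/
abbrev SpechtLattice (n : ℕ) (hn : 2 ≤ n) : Type :=
  (spechtSubrep n hn).toRepresentation.asModule

end

/-! The column stabilizer of a tableau of the hook is the stabilizer of its arm entry `b`, so up to
sign the polytabloid depends on `b` alone. The signed polytabloids `f b` span the Specht lattice,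
`g` sends `f b` to `sign g • f (g b)`, and up to multiples the only relation is `∑ b, f b = 0`. So
the lattice is ℤ^(n+1)/ℤ(1,…,1) twisted by the sign, which `IsSignedSimplex` axiomatizes
(`isSignedSimplex_spechtVector`).

Let N be a submodule of finite index. Adding to `∑ i, a i • f i` its image under the transposition
(p q) leaves `(a p - a q) • (f p - f q)` (`sub_smul_sub_mem`). Hence N is determined by two
integers: k generates the t with all `t • (f i - f j)` in N, and m generates the t with `t • f 0` in
N. Then k ∣ m ∣ k(n+1), so m = kd with d ∣ n+1 (`exists_eq_sublattice`). Each pair (k, d) with k ≥ 1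
and d ∣ n+1 occurs exactly once (`sublattice_injective`), with index k^n d (`index_sublattice`).
Summing (k^n d)^(-s) gives ζ(ns) times a divisor sum, whose Euler factors are the φ_p. -/

noncomputable section

/-! ### Signed simplices and their coefficient lattices. -/

section SignedSimplex

open Equiv.Perm

variable {n : ℕ} {V : Type*} [AddCommGroup V] [Module ℤ[Equiv.Perm (Fin (n + 1))] V]

/-- A family which spans a module over `ℤ[S_(n+1)]`, is permuted by `S_(n+1)` up to the sign
character, and satisfies only the relation that its sum vanishes. -/
structure IsSignedSimplex (f : Fin (n + 1) → V) : Prop where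
  single_smul : ∀ (g : Equiv.Perm (Fin (n + 1))) (b : Fin (n + 1)),
    (MonoidAlgebra.single g (1 : ℤ) : ℤ[Equiv.Perm (Fin (n + 1))]) • f b =
      ((sign g : ℤˣ) : ℤ) • f (g b)
  exists_sum : ∀ x : V, ∃ a : Fin (n + 1) → ℤ, ∑ i, a i • f i = x
  sum_eq_zero_iff : ∀ a : Fin (n + 1) → ℤ, ∑ i, a i • f i = 0 ↔ ∀ i j, a i = a j

/-- The coefficient vectors whose entries are congruent modulo `k`, with the sum of their
differences to any entry divisible by `k * d`. -/
def simplexCoeffs (n k d : ℕ) : AddSubgroup (Fin (n + 1) → ℤ) where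
  carrier := {a | (∀ i j, (k : ℤ) ∣ a i - a j) ∧ ∀ j, ((k * d : ℕ) : ℤ) ∣ ∑ i, (a i - a j)}
  zero_mem' := by simp
  add_mem' {a b} ha hb := by
    refine ⟨fun i j => ?_, fun j => ?_⟩
    · have := dvd_add (ha.1 i j) (hb.1 i j)
      rwa [show a i - a j + (b i - b j) = (a + b) i - (a + b) j by simp; ring] at this
    · have h : ∑ i, ((a + b) i - (a + b) j) = ∑ i, (a i - a j) + ∑ i, (b i - b j) := by
        rw [← Finset.sum_add_distrib]
        exact Finset.sum_congr rfl fun i _ => add_sub_add_comm _ _ _ _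
      exact h ▸ dvd_add (ha.2 j) (hb.2 j)
  neg_mem' {a} ha := by
    refine ⟨fun i j => ?_, fun j => ?_⟩
    · have := (ha.1 j i)
      rwa [show a j - a i = (-a) i - (-a) j by simp; ring] at this
    · have h : ∑ i, ((-a) i - (-a) j) = -∑ i, (a i - a j) := by
        rw [← Finset.sum_neg_distrib]
        exact Finset.sum_congr rfl fun i _ => (neg_sub_neg _ _).trans (neg_sub _ _).symm
      exact h ▸ dvd_neg.2 (ha.2 j)

/-- When `d ∣ n + 1`, the conditions need only be checked against one entry. -/
lemma mem_simplexCoeffs_iff {k d : ℕ} (hd : d ∣ n + 1) (j₀ : Fin (n + 1))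
    {a : Fin (n + 1) → ℤ} :
    a ∈ simplexCoeffs n k d ↔
      (∀ i, (k : ℤ) ∣ a i - a j₀) ∧ ((k * d : ℕ) : ℤ) ∣ ∑ i, (a i - a j₀) := by
  refine ⟨fun h => ⟨fun i => h.1 i j₀, h.2 j₀⟩, fun ⟨h1, h2⟩ => ⟨fun i j => ?_, fun j => ?_⟩⟩
  · have := dvd_sub (h1 i) (h1 j)
    rwa [sub_sub_sub_cancel_right] at this
  · have hs : ∑ i, (a i - a j) = ∑ i, (a i - a j₀) - (a j - a j₀) * ((n + 1 : ℕ) : ℤ) := by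
      simp only [Finset.sum_sub_distrib, Finset.sum_const, Finset.card_univ, Fintype.card_fin,
        nsmul_eq_mul]
      ring
    rw [hs]
    refine dvd_sub h2 ?_
    push_cast
    exact mul_dvd_mul (h1 j) (by exact_mod_cast hd)

lemma comp_mem_simplexCoeffs {k d : ℕ} {a : Fin (n + 1) → ℤ} (ha : a ∈ simplexCoeffs n k d)
    (g : Equiv.Perm (Fin (n + 1))) : a ∘ g ∈ simplexCoeffs n k d :=
  ⟨fun i j => ha.1 _ _, fun j => by
    have := ha.2 (g j)
    rwa [← Equiv.sum_comp g] at this⟩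

/-- The subgroup is the kernel of a surjection onto `ZMod (k * d) × (Fin m → ZMod k)`. The
difference `a 1 - a 0` is omitted from the target: its divisibility by `k` follows from that of the
sum and of the other differences. For `k = 0` both sides are 0. -/
lemma index_simplexCoeffs {m k d : ℕ} (hd : d ∣ m + 2) :
    (simplexCoeffs (m + 1) k d).index = k ^ (m + 1) * d := by
  let Ψ : (Fin (m + 2) → ℤ) →+ ZMod (k * d) × (Fin m → ZMod k) :=
    AddMonoidHom.mk' (fun a => (((∑ i, (a i - a 0) : ℤ) : ZMod (k * d)),
      fun i => ((a i.succ.succ - a 0 : ℤ) : ZMod k))) (by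
        intro a b
        ext i
        · simp only [Pi.add_apply, Prod.fst_add, ← Int.cast_add, ← Finset.sum_add_distrib]
          congr 2; ext; ring
        · simp only [Pi.add_apply, Prod.snd_add, ← Int.cast_add]
          congr 1; ring)
  have hker : Ψ.ker = simplexCoeffs (m + 1) k d := by
    ext a
    rw [AddMonoidHom.mem_ker, mem_simplexCoeffs_iff hd 0, Prod.ext_iff, funext_iff]
    simp only [Ψ, AddMonoidHom.mk'_apply, Prod.fst_zero, Prod.snd_zero, Pi.zero_apply,
      ZMod.intCast_zmod_eq_zero_iff_dvd, ZMod.intCast_zmod_eq_zero_iff_dvd]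
    constructor
    · rintro ⟨h1, h2⟩
      refine ⟨fun i => ?_, h1⟩
      have h0 : (k : ℤ) ∣ ∑ i, (a i - a 0) := (by push_cast; exact dvd_mul_right _ _ :
        (k : ℤ) ∣ ((k * d : ℕ) : ℤ)).trans h1
      rw [Fin.sum_univ_succ, Fin.sum_univ_succ, sub_self, zero_add,
        dvd_add_left (Finset.dvd_sum fun i _ => h2 i)] at h0
      refine Fin.cases (by simp) (fun i => ?_) i
      exact Fin.cases h0 h2 i
    · exact fun h => ⟨h.2, fun i => h.1 _⟩
  have hsurj : Function.Surjective Ψ := by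
    rintro ⟨u, v⟩
    obtain ⟨u, rfl⟩ := ZMod.intCast_surjective u
    choose w hw using fun i => ZMod.intCast_surjective (v i)
    -- Entry 0 vanishes, the entries from 2 on are lifts of `v`, and the free entry 1 adjusts the
    -- sum to `u`.
    refine ⟨Fin.cons 0 (Fin.cons (u - ∑ i, w i) w), ?_⟩
    ext i
    · simp [Ψ, Fin.sum_univ_succ]
    · simp [Ψ, hw]
  rw [← hker, AddSubgroup.index_ker, AddMonoidHom.range_eq_top.2 hsurj]
  simp [Nat.card_prod, Nat.card_fun, pow_succ]
  ring

/-! ### Classification of the submodules of finite index. -/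

namespace IsSignedSimplex

variable {f : Fin (n + 1) → V}

lemma single_smul_sum (hf : IsSignedSimplex f) (g : Equiv.Perm (Fin (n + 1)))
    (a : Fin (n + 1) → ℤ) :
    (MonoidAlgebra.single g (1 : ℤ) : ℤ[Equiv.Perm (Fin (n + 1))]) • ∑ i, a i • f i =
      ((sign g : ℤˣ) : ℤ) • ∑ i, (a ∘ (g⁻¹ : Equiv.Perm (Fin (n + 1)))) i • f i := by
  rw [Finset.smul_sum, ← Equiv.sum_comp g (fun i => (a ∘ _) i • f i), Finset.smul_sum]
  refine Finset.sum_congr rfl fun i _ => ?_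
  rw [smul_comm, hf.single_smul, smul_comm]
  simp

/-- The submodule of the combinations with coefficient vectors in `simplexCoeffs n k d`. -/
def sublattice (hf : IsSignedSimplex f) (k d : ℕ) :
    Submodule ℤ[Equiv.Perm (Fin (n + 1))] V where
  __ := (simplexCoeffs n k d).map (Fintype.linearCombination ℤ f).toAddMonoidHom
  smul_mem' r x hx := by
    induction r using MonoidAlgebra.induction_linear with
    | zero => rw [zero_smul]; exact AddSubgroup.zero_mem _
    | add r r' hr hr' => rw [add_smul]; exact AddSubgroup.add_mem _ hr hr'
    | single g t =>
      obtain ⟨a, ha, rfl⟩ := hx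
      have h1 : (MonoidAlgebra.single g t : ℤ[Equiv.Perm (Fin (n + 1))]) =
          t • MonoidAlgebra.single g 1 := by
        rw [MonoidAlgebra.smul_single, smul_eq_mul, mul_one]
      rw [h1, smul_assoc]
      refine AddSubgroup.zsmul_mem _ ?_ t
      refine ⟨((sign g : ℤˣ) : ℤ) • (a ∘ (g⁻¹ : Equiv.Perm (Fin (n + 1)))),
        AddSubgroup.zsmul_mem _ (comp_mem_simplexCoeffs ha _) _, ?_⟩
      rw [map_zsmul]
      exact (hf.single_smul_sum g a).symm

lemma toAddSubgroup_sublattice (hf : IsSignedSimplex f) (k d : ℕ) :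
    (hf.sublattice k d).toAddSubgroup =
      (simplexCoeffs n k d).map (Fintype.linearCombination ℤ f).toAddMonoidHom := rfl

lemma linearCombination_surjective (hf : IsSignedSimplex f) :
    Function.Surjective (Fintype.linearCombination ℤ f).toAddMonoidHom :=
  hf.exists_sum

/-- The kernel consists of the constant vectors. Therefore membership in `sublattice` can be read
off from any coefficient vector of an element, as in `sum_mem_sublattice`. -/
lemma ker_le_simplexCoeffs (hf : IsSignedSimplex f) (k d : ℕ) :
    (Fintype.linearCombination ℤ f).toAddMonoidHom.ker ≤ simplexCoeffs n k d := by
  intro a ha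
  have h := (hf.sum_eq_zero_iff a).1 ha
  exact ⟨fun i j => by simp [h i j], fun j => by simp [h _ j]⟩

lemma comap_sublattice (hf : IsSignedSimplex f) (k d : ℕ) :
    (hf.sublattice k d).toAddSubgroup.comap (Fintype.linearCombination ℤ f).toAddMonoidHom =
      simplexCoeffs n k d := by
  rw [toAddSubgroup_sublattice, AddSubgroup.comap_map_eq,
    sup_eq_left.2 (hf.ker_le_simplexCoeffs k d)]

lemma sum_mem_sublattice (hf : IsSignedSimplex f) {k d : ℕ} {a : Fin (n + 1) → ℤ} :
    ∑ i, a i • f i ∈ hf.sublattice k d ↔ a ∈ simplexCoeffs n k d := by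
  rw [← hf.comap_sublattice k d]
  rfl

lemma index_sublattice (hf : IsSignedSimplex f) (hn : n ≠ 0) {k d : ℕ} (hd : d ∣ n + 1) :
    (hf.sublattice k d).toAddSubgroup.index = k ^ n * d := by
  rw [← AddSubgroup.index_comap_of_surjective _ hf.linearCombination_surjective,
    hf.comap_sublattice]
  obtain ⟨m, rfl⟩ := Nat.exists_eq_succ_of_ne_zero hn
  exact index_simplexCoeffs hd

/-- This recovers `k` from the submodule. It needs `2 ≤ n`: a third index, where the coefficient of
`t • (f 0 - f 1)` is 0, exhibits `t` itself as a difference of entries; with two indices only `2 *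
t` would appear. -/
lemma smul_sub_mem_sublattice (hf : IsSignedSimplex f) (hn : 2 ≤ n) {k d : ℕ} (hd : d ∣ n + 1)
    (t : ℤ) : (∀ i j, t • (f i - f j) ∈ hf.sublattice k d) ↔ (k : ℤ) ∣ t := by
  have hsum : ∀ i j, t • (f i - f j) =
      ∑ l, (Pi.single i t - Pi.single j t : Fin (n + 1) → ℤ) l • f l := by
    intro i j
    simp [sub_smul, smul_sub, Pi.single_apply, Finset.sum_sub_distrib]
  constructor
  · intro h
    have h01 := h ⟨0, by omega⟩ ⟨1, by omega⟩
    rw [hsum, sum_mem_sublattice] at h01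
    simpa [Pi.single_apply, Fin.ext_iff] using h01.1 ⟨0, by omega⟩ ⟨2, by omega⟩
  · intro h i j
    rw [hsum, sum_mem_sublattice]
    refine ⟨fun l l' => ?_, fun l => ?_⟩
    · simp only [Pi.sub_apply, Pi.single_apply]
      refine dvd_sub (dvd_sub ?_ ?_) (dvd_sub ?_ ?_) <;> split_ifs <;> simp [h]
    · rw [Finset.sum_sub_distrib]
      simp only [Pi.sub_apply, Finset.sum_sub_distrib, Finset.sum_pi_single', Finset.mem_univ,
        if_true, sub_self, zero_sub, Finset.sum_const, Finset.card_univ, Fintype.card_fin,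
        nsmul_eq_mul, dvd_neg]
      rw [← mul_sub, mul_comm, Nat.cast_mul]
      refine mul_dvd_mul (by exact_mod_cast hd) ?_
      simp only [Pi.single_apply]
      refine dvd_sub ?_ ?_ <;> split_ifs <;> simp [h]

/-- This recovers `k * d`. The base entry is taken at `Fin.last n`, where the coefficient of `t • f
0` vanishes, so that the sum of differences is `t`. -/
lemma smul_mem_sublattice (hf : IsSignedSimplex f) {k d : ℕ} (hd : d ∣ n + 1)
    (hn : n ≠ 0) (t : ℤ) : t • f 0 ∈ hf.sublattice k d ↔ ((k * d : ℕ) : ℤ) ∣ t := by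
  have hsum : t • f 0 = ∑ l, (Pi.single 0 t : Fin (n + 1) → ℤ) l • f l := by
    simp [Pi.single_apply]
  have : NeZero n := ⟨hn⟩
  rw [hsum, sum_mem_sublattice, mem_simplexCoeffs_iff hd (Fin.last n)]
  have h0 : (Pi.single 0 t : Fin (n + 1) → ℤ) (Fin.last n) = 0 := by
    simp [Fin.ext_iff, hn]
  simp only [h0, sub_zero, Finset.sum_pi_single', Finset.mem_univ, if_true, and_iff_right_iff_imp]
  intro h i
  rw [Pi.single_apply]
  split_ifs
  · exact (by push_cast; exact dvd_mul_right _ _ : (k : ℤ) ∣ ((k * d : ℕ) : ℤ)).trans h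
  · simp

lemma sublattice_injective (hf : IsSignedSimplex f) (hn : 2 ≤ n) {k d k' d' : ℕ} (hk : k ≠ 0)
    (hd : d ∣ n + 1) (hd' : d' ∣ n + 1) (h : hf.sublattice k d = hf.sublattice k' d') :
    k = k' ∧ d = d' := by
  have h1 : ∀ t : ℤ, (k : ℤ) ∣ t ↔ (k' : ℤ) ∣ t := fun t => by
    rw [← hf.smul_sub_mem_sublattice hn hd, ← hf.smul_sub_mem_sublattice hn hd', h]
  have h2 : ∀ t : ℤ, ((k * d : ℕ) : ℤ) ∣ t ↔ ((k' * d' : ℕ) : ℤ) ∣ t := fun t => by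
    rw [← hf.smul_mem_sublattice hd (by omega), ← hf.smul_mem_sublattice hd' (by omega), h]
  have hkk : k = k' := Nat.dvd_antisymm (Int.natCast_dvd_natCast.1 ((h1 _).2 dvd_rfl))
    (Int.natCast_dvd_natCast.1 ((h1 _).1 dvd_rfl))
  have hkd : k * d = k' * d' := Nat.dvd_antisymm (Int.natCast_dvd_natCast.1 ((h2 _).2 dvd_rfl))
    (Int.natCast_dvd_natCast.1 ((h2 _).1 dvd_rfl))
  subst hkk
  exact ⟨rfl, Nat.eq_of_mul_eq_mul_left (Nat.pos_of_ne_zero hk) hkd⟩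

/-- A submodule contains, with `∑ i, a i • f i`, all multiples of the `f i - f j` by differences
of the coefficients. -/
lemma sub_smul_sub_mem (hf : IsSignedSimplex f)
    (N : Submodule ℤ[Equiv.Perm (Fin (n + 1))] V) {a : Fin (n + 1) → ℤ}
    (ha : ∑ i, a i • f i ∈ N) (p q i j : Fin (n + 1)) : (a p - a q) • (f i - f j) ∈ N := by
  rcases eq_or_ne p q with rfl | hpq
  · simp
  rcases eq_or_ne i j with rfl | hij
  · simp
  -- The transposition acts with sign -1, so all terms outside `{p, q}` cancel in the sum of the
  -- element and its image.
  have hmem : (a p - a q) • (f p - f q) ∈ N := by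
    have h := N.add_mem ha (N.smul_mem (MonoidAlgebra.single (Equiv.swap p q) (1 : ℤ)) ha)
    rw [hf.single_smul_sum, sign_swap hpq] at h
    convert h using 1
    rw [Units.val_neg, Units.val_one, neg_smul, one_smul, ← sub_eq_add_neg,
      ← Finset.sum_sub_distrib, ← Finset.sum_subset (Finset.subset_univ {p, q}),
      Finset.sum_pair hpq]
    · simp only [Equiv.swap_inv, Function.comp_apply, Equiv.swap_apply_left,
        Equiv.swap_apply_right]
      module
    · intro l _ hl
      simp only [Finset.mem_insert, Finset.mem_singleton, not_or] at hl
      simp [Equiv.swap_apply_of_ne_of_ne hl.1 hl.2]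
  -- Double transitivity: move `p` to `i`, then the image of `q` to `j` by a transposition that
  -- fixes `i`.
  obtain ⟨g, hgp, hgq⟩ : ∃ g : Equiv.Perm (Fin (n + 1)), g p = i ∧ g q = j := by
    have hne : Equiv.swap p i q ≠ i := fun h =>
      hpq ((Equiv.swap p i).injective (h.trans (Equiv.swap_apply_left p i).symm)).symm
    refine ⟨Equiv.swap (Equiv.swap p i q) j * Equiv.swap p i, ?_, ?_⟩
    · rw [Equiv.Perm.mul_apply, Equiv.swap_apply_left,
        Equiv.swap_apply_of_ne_of_ne hne.symm hij]
    · rw [Equiv.Perm.mul_apply, Equiv.swap_apply_left]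
  have h := N.smul_mem (MonoidAlgebra.single g (1 : ℤ)) hmem
  rw [smul_comm, smul_sub, hf.single_smul, hf.single_smul, hgp, hgq] at h
  rcases Int.units_eq_one_or (sign g) with h1 | h1
  · simpa [h1] using h
  · rw [h1, ← smul_sub, Units.val_neg, Units.val_one, neg_smul, one_smul, smul_neg] at h
    exact neg_mem_iff.1 h

/-- Every submodule of finite index is one of the `sublattice`s. -/
lemma exists_eq_sublattice (hf : IsSignedSimplex f) (hn : n ≠ 0)
    (N : Submodule ℤ[Equiv.Perm (Fin (n + 1))] V) (hN : N.toAddSubgroup.FiniteIndex) :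
    ∃ k d : ℕ, k ≠ 0 ∧ d ∣ n + 1 ∧ N = hf.sublattice k d := by
  let A : AddSubgroup ℤ :=
    { carrier := {t | ∀ i j, t • (f i - f j) ∈ N}
      zero_mem' := by simp
      add_mem' := fun ha hb i j => by rw [add_smul]; exact N.add_mem (ha i j) (hb i j)
      neg_mem' := fun ha i j => by rw [neg_smul]; exact N.neg_mem (ha i j) }
  let B : AddSubgroup ℤ := N.toAddSubgroup.comap (zmultiplesHom V (f 0))
  have memB : ∀ t, t ∈ B ↔ t • f 0 ∈ N := fun t => Iff.rfl
  have exists_gen : ∀ C : AddSubgroup ℤ, ∃ k : ℕ, ∀ t, t ∈ C ↔ (k : ℤ) ∣ t := by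
    intro C
    obtain ⟨a, ha⟩ := Int.subgroup_cyclic C
    refine ⟨a.natAbs, fun t => ?_⟩
    rw [ha, AddSubgroup.mem_closure_singleton, Int.natAbs_dvd]
    exact ⟨fun ⟨c, hc⟩ => ⟨c, by rw [← hc, smul_eq_mul, mul_comm]⟩,
      fun ⟨c, hc⟩ => ⟨c, by rw [hc, smul_eq_mul, mul_comm]⟩⟩
  obtain ⟨k, hk⟩ := exists_gen A
  obtain ⟨m, hm⟩ := exists_gen B
  have memA : ∀ t, (k : ℤ) ∣ t ↔ ∀ i j, t • (f i - f j) ∈ N := fun t => (hk t).symm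
  have hsum0 : ∑ i, f i = 0 := by simpa using (hf.sum_eq_zero_iff 1).2 (by simp)
  -- Once `k` divides all `a i - a 0`, the first sum lies in `N`, and membership is decided by the
  -- multiple of `f 0` alone.
  have hdecomp : ∀ a : Fin (n + 1) → ℤ,
      ∑ i, a i • f i = ∑ i, (a i - a 0) • (f i - f 0) + (∑ i, (a i - a 0)) • f 0 := by
    intro a
    rw [Finset.sum_smul, ← Finset.sum_add_distrib]
    simp_rw [← smul_add, sub_add_cancel, sub_smul]
    rw [Finset.sum_sub_distrib, ← Finset.smul_sum, hsum0, smul_zero, sub_zero]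
  have hdiff : ∀ a : Fin (n + 1) → ℤ, ∑ i, a i • f i ∈ N → ∀ i j, (k : ℤ) ∣ a i - a j :=
    fun a ha p q => (memA _).2 (hf.sub_smul_sub_mem N ha p q)
  have hmk : m ∣ k * (n + 1) := by
    rw [← Int.natCast_dvd_natCast, ← hm, memB]
    -- Since the `f i` sum to zero, `(n + 1) • f 0` is minus the sum of the `f i - f 0`.
    have : ((k * (n + 1) : ℕ) : ℤ) • f 0 = -∑ i, (k : ℤ) • (f i - f 0) := by
      rw [← Finset.smul_sum, Finset.sum_sub_distrib, hsum0]
      simp only [Finset.sum_const, Finset.card_univ, Fintype.card_fin, zero_sub, smul_neg, neg_neg]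
      rw [← natCast_zsmul, smul_smul, Nat.cast_mul]
    rw [this]
    exact N.neg_mem (N.sum_mem fun i _ => (memA _).1 dvd_rfl i 0)
  have hkm : k ∣ m := by
    rw [← Int.natCast_dvd_natCast]
    have h := (hm m).2 dvd_rfl
    rw [memB] at h
    have h' : ∑ l, (Pi.single 0 (m : ℤ) : Fin (n + 1) → ℤ) l • f l ∈ N := by
      simpa [Pi.single_apply] using h
    have := hdiff _ h' 0 (Fin.last n)
    rwa [Pi.single_eq_same, Pi.single_eq_of_ne (by simp [Fin.ext_iff, hn]), sub_zero] at this
  -- The index annihilates the quotient by `N`, so it is a nonzero multiple of `k`.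
  have hk0 : k ≠ 0 := by
    have hi : N.toAddSubgroup.index ≠ 0 := hN.index_ne_zero
    have : (k : ℤ) ∣ N.toAddSubgroup.index := (memA _).2 fun i j => by
      rw [natCast_zsmul]
      exact N.toAddSubgroup.nsmul_index_mem _
    rintro rfl
    exact hi (by simpa using this)
  obtain ⟨d, rfl⟩ := hkm
  have hd : d ∣ n + 1 := Nat.dvd_of_mul_dvd_mul_left (Nat.pos_of_ne_zero hk0) hmk
  refine ⟨k, d, hk0, hd, ?_⟩
  ext x
  obtain ⟨a, rfl⟩ := hf.exists_sum x
  rw [sum_mem_sublattice, mem_simplexCoeffs_iff hd 0, ← hm, memB]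
  have hiff : (∀ i, (k : ℤ) ∣ a i - a 0) →
      (∑ i, a i • f i ∈ N ↔ (∑ i, (a i - a 0)) • f 0 ∈ N) := fun h => by
    rw [hdecomp]
    exact N.add_mem_iff_right (N.sum_mem fun i _ => (memA _).1 (h i) i 0)
  exact ⟨fun h => ⟨fun i => hdiff a h i 0, (hiff fun i => hdiff a h i 0).1 h⟩,
    fun h => (hiff h.1).2 h.2⟩

end IsSignedSimplex

end SignedSimplex
/-! ### The Specht lattice of the hook -/

section SpechtLattice

open YTableau Equiv.Perm

lemma nonempty_hook_tableau {n : ℕ} (hn : 2 ≤ n) : Nonempty (YTableau (hook n) (n + 1)) := by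
  refine ⟨Fintype.equivFinOfCardEq ?_⟩
  have h : (hook n).cells = insert (0, 1) (Finset.range n ×ˢ {0}) := by
    ext c
    rw [mem_hook hn, Finset.mem_insert, Finset.mem_product, Finset.mem_range,
      Finset.mem_singleton]
  rw [Fintype.card_coe, h, Finset.card_insert_of_notMem (by simp)]
  simp

/-- The permutation `g * h⁻¹` fixes the arm entry of `act h S`, hence lies in its column stabilizer
and acts on its polytabloid by its sign. -/
lemma polytabloid_eq_of_arm {n : ℕ} (hn : 2 ≤ n) (S : YTableau (hook n) (n + 1))
    {g h : Equiv.Perm (Fin (n + 1))} (hgh : g (S (hookArm hn)) = h (S (hookArm hn))) :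
    ((sign g : ℤˣ) : ℤ) • polytabloid (act g S) =
      ((sign h : ℤˣ) : ℤ) • polytabloid (act h S) := by
  have hmem : g * h⁻¹ ∈ (act h S).colStab := by
    rw [mem_colStab_hook hn]
    simp [act, hgh]
  have h1 := polytabloid_act_of_mem hmem
  rw [← act_mul, inv_mul_cancel_right] at h1
  rw [h1, smul_smul]
  congr 1
  rcases Int.units_eq_one_or (sign g) with h2 | h2 <;>
    rcases Int.units_eq_one_or (sign h) with h3 | h3 <;> simp [h2, h3]

/-- The polytabloid with arm entry `b`, with the sign that makes it depend on `b` and the reference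
tableau `S` only. -/
def armPolytabloid {n : ℕ} (hn : 2 ≤ n) (S : YTableau (hook n) (n + 1)) (b : Fin (n + 1)) :
    ℤ[Tabloid (hook n) (n + 1)] :=
  ((sign (Equiv.swap (S (hookArm hn)) b) : ℤˣ) : ℤ) •
    polytabloid (act (Equiv.swap (S (hookArm hn)) b) S)

lemma armPolytabloid_mem {n : ℕ} (hn : 2 ≤ n) (S : YTableau (hook n) (n + 1))
    (b : Fin (n + 1)) : armPolytabloid hn S b ∈ standardSpan (hook n) (n + 1) :=
  Submodule.smul_mem _ _ (polytabloid_mem hn _)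

lemma smul_polytabloid_act {n : ℕ} (hn : 2 ≤ n) (S : YTableau (hook n) (n + 1))
    (g : Equiv.Perm (Fin (n + 1))) :
    ((sign g : ℤˣ) : ℤ) • polytabloid (act g S) =
      armPolytabloid hn S (g (S (hookArm hn))) :=
  polytabloid_eq_of_arm hn S (by simp)

lemma polytabloid_act {n : ℕ} (hn : 2 ≤ n) (S : YTableau (hook n) (n + 1))
    (g : Equiv.Perm (Fin (n + 1))) :
    polytabloid (act g S) =
      ((sign g : ℤˣ) : ℤ) • armPolytabloid hn S (g (S (hookArm hn))) := by
  rw [← smul_polytabloid_act, smul_smul, ← Units.val_mul, Int.units_mul_self, Units.val_one,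
    one_smul]

lemma tabloidRep_armPolytabloid {n : ℕ} (hn : 2 ≤ n) (S : YTableau (hook n) (n + 1))
    (g : Equiv.Perm (Fin (n + 1))) (b : Fin (n + 1)) :
    tabloidRep (hook n) (n + 1) g (armPolytabloid hn S b) =
      ((sign g : ℤˣ) : ℤ) • armPolytabloid hn S (g b) := by
  rw [armPolytabloid, map_smul, tabloidRep_polytabloid, ← act_mul, polytabloid_act hn, smul_smul,
    Equiv.Perm.sign_mul, ← Units.val_mul, mul_comm, mul_assoc, Int.units_mul_self, mul_one,
    Equiv.Perm.mul_apply, Equiv.swap_apply_left]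

lemma sum_armPolytabloid {n : ℕ} (hn : 2 ≤ n) (S : YTableau (hook n) (n + 1)) :
    ∑ b, armPolytabloid hn S b = 0 :=
  sum_polytabloid_eq_zero hn S

lemma standardSpan_eq_span_armPolytabloid {n : ℕ} (hn : 2 ≤ n)
    (S : YTableau (hook n) (n + 1)) :
    standardSpan (hook n) (n + 1) = Submodule.span ℤ (Set.range (armPolytabloid hn S)) := by
  apply le_antisymm
  · refine Submodule.span_le.2 ?_
    rintro _ ⟨T, -, rfl⟩
    have hT : T = act (S.symm.trans T) S := by
      ext c; simp [act]
    rw [hT, polytabloid_act hn]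
    exact Submodule.smul_mem _ _ (Submodule.subset_span ⟨_, rfl⟩)
  · refine Submodule.span_le.2 ?_
    rintro _ ⟨b, rfl⟩
    exact armPolytabloid_mem hn S b

/-- The corner of the hook. -/
def hookCorner {n : ℕ} (hn : 2 ≤ n) : (hook n).cells :=
  ⟨(0, 0), (mem_hook hn).2 (Or.inr ⟨by simp; omega, rfl⟩)⟩

lemma hookCorner_ne_hookArm {n : ℕ} (hn : 2 ≤ n) : hookCorner hn ≠ hookArm hn := by
  simp [hookCorner, hookArm]

lemma eq_or_of_rowOf_eq {n : ℕ} (hn : 2 ≤ n) (S : YTableau (hook n) (n + 1))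
    {x y : Fin (n + 1)} (h : S.rowOf x = S.rowOf y) :
    x = y ∨ (x = S (hookCorner hn) ∧ y = S (hookArm hn)) ∨
      (x = S (hookArm hn) ∧ y = S (hookCorner hn)) := by
  obtain ⟨c, rfl⟩ := S.surjective x
  obtain ⟨c', rfl⟩ := S.surjective y
  simp only [rowOf, Equiv.symm_apply_apply] at h
  simp only [S.injective.eq_iff, Subtype.ext_iff, hookCorner, hookArm, Prod.ext_iff]
  have h1 := (mem_hook hn).1 c.2
  have h2 := (mem_hook hn).1 c'.2
  simp only [Prod.ext_iff] at h1 h2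
  omega

/-- Only the first row has two cells, so a permutation preserving the rows of `S` can at most
exchange the corner and arm entries. -/
lemma mk_act_eq_mk_iff {n : ℕ} (hn : 2 ≤ n) (S : YTableau (hook n) (n + 1))
    (g : Equiv.Perm (Fin (n + 1))) :
    Tabloid.mk (act g S) = Tabloid.mk S ↔
      g = 1 ∨ g = Equiv.swap (S (hookCorner hn)) (S (hookArm hn)) := by
  set c := S (hookCorner hn) with hc
  set b := S (hookArm hn) with hb
  have hcb : c ≠ b := S.injective.ne (hookCorner_ne_hookArm hn)
  have hrow : S.rowOf c = S.rowOf b := by simp [rowOf, hc, hb, hookCorner, hookArm]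
  rw [Tabloid.mk_eq_mk]
  constructor
  · intro h
    have h' : ∀ y, g y = y ∨ (g y = c ∧ y = b) ∨ (g y = b ∧ y = c) := fun y =>
      eq_or_of_rowOf_eq hn S (by simpa using (h (g y)).symm)
    have hfix : ∀ y, y ≠ c → y ≠ b → g y = y := fun y h1 h2 => by simpa [h1, h2] using h' y
    by_cases hg : g c = c
    · left
      ext1 y
      rcases eq_or_ne y c with rfl | h1
      · exact hg
      rcases h' y with h2 | ⟨h2, -⟩ | ⟨-, h2⟩
      · exact h2
      · exact absurd (g.injective (h2.trans hg.symm)) h1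
      · exact absurd h2 h1
    · right
      have hgc : g c = b := by simpa [hg, hcb] using h' c
      have hgb : g b = c := by
        rcases h' b with h2 | ⟨h2, -⟩ | ⟨-, h2⟩
        · exact absurd (g.injective (hgc.trans h2.symm)) hcb
        · exact h2
        · exact absurd h2.symm hcb
      ext1 y
      rcases eq_or_ne y c with rfl | h1
      · rw [hgc, Equiv.swap_apply_left]
      rcases eq_or_ne y b with rfl | h2
      · rw [hgb, Equiv.swap_apply_right]
      rw [hfix y h1 h2, Equiv.swap_apply_of_ne_of_ne h1 h2]
  · rintro (rfl | rfl) x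
    · rfl
    · rw [rowOf_act, Equiv.swap_inv]
      rcases eq_or_ne x c with rfl | h1
      · rw [Equiv.swap_apply_left, hrow]
      rcases eq_or_ne x b with rfl | h2
      · rw [Equiv.swap_apply_right, hrow]
      rw [Equiv.swap_apply_of_ne_of_ne h1 h2]

lemma armPolytabloid_eq_sum {n : ℕ} (hn : 2 ≤ n) (S : YTableau (hook n) (n + 1))
    (b : Fin (n + 1)) :
    armPolytabloid hn S b = ∑ g : Equiv.Perm (Fin (n + 1)) with g (S (hookArm hn)) = b,
      MonoidAlgebra.single (Tabloid.mk (S.act g)) ((sign g : ℤˣ) : ℤ) := by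
  have harm : act (Equiv.swap (S (hookArm hn)) b) S (hookArm hn) = b := by simp [act]
  unfold armPolytabloid polytabloid
  rw [Finset.smul_sum]
  refine Finset.sum_bij' (fun g _ => g * Equiv.swap (S (hookArm hn)) b)
    (fun g _ => g * Equiv.swap (S (hookArm hn)) b) ?_ ?_ ?_ ?_ ?_
  · intro g hg
    rw [mem_colStab_hook hn, harm] at hg
    simp [hg]
  · intro g hg
    rw [mem_colStab_hook hn, harm]
    simpa using hg
  · intro g _; simp [mul_assoc]
  · intro g _; simp [mul_assoc]
  · intro g _
    rw [act_mul, MonoidAlgebra.smul_single, Equiv.Perm.sign_mul, Units.val_mul, smul_eq_mul,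
      mul_comm]

/-- Only 1 and the transposition of the first row contribute to the tabloid of `S`. They have
opposite signs and send the arm entry to itself and to the corner entry respectively. -/
lemma coeff_armPolytabloid {n : ℕ} (hn : 2 ≤ n) (S : YTableau (hook n) (n + 1))
    (b : Fin (n + 1)) :
    (armPolytabloid hn S b).coeff (Tabloid.mk S) =
      (if b = S (hookArm hn) then 1 else 0) - if b = S (hookCorner hn) then 1 else 0 := by
  classical
  have hcb : S (hookCorner hn) ≠ S (hookArm hn) := S.injective.ne (hookCorner_ne_hookArm hn)
  set τ := Equiv.swap (S (hookCorner hn)) (S (hookArm hn)) with hτ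
  have hτ1 : τ ≠ 1 := fun h => hcb (Equiv.swap_eq_one_iff.1 h)
  have hsign : ((sign τ : ℤˣ) : ℤ) = -1 := by rw [hτ, sign_swap hcb]; rfl
  have hsplit : ∀ g : Equiv.Perm (Fin (n + 1)),
      (if g = 1 ∨ g = τ then ((sign g : ℤˣ) : ℤ) else 0) =
        (if g = 1 then 1 else 0) - if g = τ then 1 else 0 := by
    intro g
    rcases eq_or_ne g 1 with rfl | h1
    · simp [hτ1.symm]
    rcases eq_or_ne g τ with rfl | h2
    · simp [hτ1, hsign]
    · simp [h1, h2]
  rw [armPolytabloid_eq_sum, MonoidAlgebra.coeff_sum, Finset.sum_apply']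
  simp only [MonoidAlgebra.coeff_single, Finsupp.single_apply, mk_act_eq_mk_iff hn, ← hτ, hsplit]
  rw [Finset.sum_sub_distrib, Finset.sum_ite_eq', Finset.sum_ite_eq']
  simp [hτ, eq_comm]

/-- The coefficient of the tabloid of `S` in the sum is the difference of `a` at the arm and corner
entries. Applying first the transposition of `i` with the corner entry replaces the latter by `a i`.
-/
lemma sum_smul_armPolytabloid_eq_zero_iff {n : ℕ} (hn : 2 ≤ n)
    (S : YTableau (hook n) (n + 1)) (a : Fin (n + 1) → ℤ) :
    ∑ i, a i • armPolytabloid hn S i = 0 ↔ ∀ i j, a i = a j := by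
  refine ⟨fun h => ?_, fun h => ?_⟩
  · suffices H : ∀ i, i ≠ S (hookArm hn) → a (S (hookArm hn)) = a i by
      have H' : ∀ i, a (S (hookArm hn)) = a i := fun i => by
        rcases eq_or_ne i (S (hookArm hn)) with rfl | hi
        · rfl
        · exact H i hi
      exact fun i j => (H' i).symm.trans (H' j)
    intro i hi
    have hc : S (hookCorner hn) ≠ S (hookArm hn) :=
      S.injective.ne (hookCorner_ne_hookArm hn)
    have h1 := congrArg (tabloidRep (hook n) (n + 1) (Equiv.swap i (S (hookCorner hn)))) h
    simp only [map_sum, map_smul, tabloidRep_armPolytabloid, map_zero] at h1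
    simp_rw [smul_comm (a _), ← Finset.smul_sum] at h1
    rw [smul_eq_zero_iff_right (Units.ne_zero _),
      ← Equiv.sum_comp (Equiv.swap i (S (hookCorner hn)))] at h1
    have h2 := congrArg (fun x => x.coeff (Tabloid.mk S)) h1
    simp [MonoidAlgebra.coeff_sum, coeff_armPolytabloid, mul_sub, Finset.sum_sub_distrib] at h2
    rw [Equiv.swap_apply_of_ne_of_ne hi.symm hc.symm, sub_eq_zero] at h2
    exact h2
  · rw [Finset.sum_congr rfl fun i _ => by rw [h i 0], ← Finset.smul_sum, sum_armPolytabloid,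
      smul_zero]

/-- The signed polytabloids as elements of the Specht lattice. -/
def spechtVector {n : ℕ} (hn : 2 ≤ n) (S : YTableau (hook n) (n + 1)) (b : Fin (n + 1)) :
    SpechtLattice n hn :=
  (spechtSubrep n hn).toRepresentation.asModuleEquiv.symm
    ⟨armPolytabloid hn S b, armPolytabloid_mem hn S b⟩

lemma isSignedSimplex_spechtVector {n : ℕ} (hn : 2 ≤ n) (S : YTableau (hook n) (n + 1)) :
    IsSignedSimplex (spechtVector hn S) := by
  -- The three axioms are checked in the tabloid module, along this additive injection.
  let ι : SpechtLattice n hn →+ ℤ[Tabloid (hook n) (n + 1)] :=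
    (standardSpan (hook n) (n + 1)).subtype.toAddMonoidHom.comp
      (spechtSubrep n hn).toRepresentation.asModuleEquiv.toAddMonoidHom
  have hι : Function.Injective ι := fun x y h =>
    (spechtSubrep n hn).toRepresentation.asModuleEquiv.injective (Subtype.ext h)
  have hιv : ∀ b, ι (spechtVector hn S b) = armPolytabloid hn S b := fun b => rfl
  refine ⟨fun g b => hι ?_, fun x => ?_, fun a => ?_⟩
  · rw [map_zsmul, hιv, ← tabloidRep_armPolytabloid, Representation.single_smul, one_smul]
    rfl
  · have hx : ι x ∈ Submodule.span ℤ (Set.range (armPolytabloid hn S)) := by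
      rw [← standardSpan_eq_span_armPolytabloid]
      exact ((spechtSubrep n hn).toRepresentation.asModuleEquiv x).2
    obtain ⟨a, ha⟩ := (Submodule.mem_span_range_iff_exists_fun ℤ).1 hx
    refine ⟨a, hι ?_⟩
    simp only [map_sum, map_zsmul, hιv, ha]
  · rw [← sum_smul_armPolytabloid_eq_zero_iff hn S a, ← map_eq_zero_iff ι hι]
    simp only [map_sum, map_zsmul, hιv]

end SpechtLattice
-- Euler factors of the divisor sum, and the zeta function.
-- The divisor sum is the Dirichlet convolution of two multiplicative functions, so it factors over
-- primes into geometric sums. Positivity of `s.re` gives `|p ^ (-s)| < 1`, so the denominators do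
-- not vanish.
lemma sum_divisors_cpow_neg {N : ℕ} (hN : N ≠ 0) {s : ℂ} (hs : 0 < s.re) :
    ∑ d ∈ N.divisors, (d : ℂ) ^ (-s) =
      ∏ p ∈ N.primeFactors,
        (((p : ℂ) ^ (-s)) ^ (padicValNat p N + 1) - 1) / ((p : ℂ) ^ (-s) - 1) := by
  have hs0 : -s ≠ 0 := fun h => by simp [neg_eq_zero.1 h] at hs
  let g : ArithmeticFunction ℂ := ⟨fun d => (d : ℂ) ^ (-s), by simp [Complex.zero_cpow hs0]⟩
  have hg : g.IsMultiplicative := by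
    refine ⟨by simp [g], fun {m n} _ => ?_⟩
    simp only [g, ArithmeticFunction.coe_mk]
    rw [Nat.cast_mul, Complex.natCast_mul_natCast_cpow]
  have hz : (g * (ArithmeticFunction.zeta : ArithmeticFunction ℂ)).IsMultiplicative :=
    hg.mul ArithmeticFunction.isMultiplicative_zeta.natCast
  have hsum : ∀ m, (g * (ArithmeticFunction.zeta : ArithmeticFunction ℂ)) m =
      ∑ d ∈ m.divisors, (d : ℂ) ^ (-s) := fun m => by
    rw [ArithmeticFunction.coe_mul_zeta_apply]
    rfl
  rw [← hsum, hz.multiplicative_factorization _ hN, Finsupp.prod, Nat.support_factorization]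
  refine Finset.prod_congr rfl fun p hp => ?_
  have hpp := Nat.prime_of_mem_primeFactors hp
  have hne : (p : ℂ) ^ (-s) ≠ 1 := fun h => by
    have h1 := congrArg norm h
    rw [Complex.norm_natCast_cpow_of_pos hpp.pos, norm_one] at h1
    exact (Real.rpow_lt_one_of_one_lt_of_neg (by exact_mod_cast hpp.one_lt)
      (by simpa using hs)).ne h1
  rw [hsum, Nat.sum_divisors_prime_pow hpp, ← Nat.factorization_def N hpp, ← geom_sum_eq hne]
  refine Finset.sum_congr rfl fun i _ => ?_
  rw [Nat.cast_pow, ← Complex.natCast_cpow_natCast_mul, Complex.cpow_nat_mul]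

namespace IsSignedSimplex

variable {n : ℕ} {V : Type*} [AddCommGroup V] [Module ℤ[Equiv.Perm (Fin (n + 1))] V]
  {f : Fin (n + 1) → V}

/-- The classification of the sublattices of finite index, by a positive integer and a divisor
of `n + 1`. -/
def finiteIndexEquiv (hf : IsSignedSimplex f) (hn : 2 ≤ n) :
    ℕ × (n + 1).divisors ≃ FiniteIndexSublattice ℤ[Equiv.Perm (Fin (n + 1))] V :=
  Equiv.ofBijective
    -- The natural number `x.1` stands for `k - 1`, which matches the shifted series for the zeta
    -- function.
    (fun x => ⟨hf.sublattice (x.1 + 1) x.2, ⟨by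
      have hd := Nat.dvd_of_mem_divisors x.2.2
      rw [hf.index_sublattice (by omega) hd]
      exact mul_ne_zero (pow_ne_zero _ (by omega)) (ne_zero_of_dvd_ne_zero (by omega) hd)⟩⟩) (by
    constructor
    · rintro ⟨k, d, hd⟩ ⟨k', d', hd'⟩ h
      obtain ⟨h1, rfl⟩ := hf.sublattice_injective hn (Nat.succ_ne_zero k)
        (Nat.dvd_of_mem_divisors hd) (Nat.dvd_of_mem_divisors hd') (congrArg Subtype.val h)
      obtain rfl : k = k' := by omega
      rfl
    · rintro ⟨N, hN⟩
      obtain ⟨k, d, hk, hd, rfl⟩ := hf.exists_eq_sublattice (by omega) N hN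
      refine ⟨(k - 1, ⟨d, Nat.mem_divisors.2 ⟨hd, by omega⟩⟩), Subtype.ext ?_⟩
      simp [Nat.sub_add_cancel (Nat.pos_of_ne_zero hk)])

lemma solomonTerm_finiteIndexEquiv (hf : IsSignedSimplex f) (hn : 2 ≤ n) (s : ℂ)
    (x : ℕ × (n + 1).divisors) :
    solomonTerm s (hf.finiteIndexEquiv hn x) =
      1 / ((x.1 : ℂ) + 1) ^ (n * s) * ((x.2 : ℕ) : ℂ) ^ (-s) := by
  have h : (hf.finiteIndexEquiv hn x).1.toAddSubgroup.index = (x.1 + 1) ^ n * x.2 :=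
    hf.index_sublattice (by omega) (Nat.dvd_of_mem_divisors x.2.2)
  rw [solomonTerm, h, Nat.cast_mul, Complex.natCast_mul_natCast_cpow, Nat.cast_pow,
    ← Complex.natCast_cpow_natCast_mul, mul_neg, Complex.cpow_neg, one_div, Nat.cast_succ]

/-- The index `k ^ n * d` separates the variables: the series is the product of an absolutely
convergent Dirichlet series at `n * s`, of real part greater than 1, and a finite sum. -/
theorem summable_and_solomonZeta_eq (hf : IsSignedSimplex f) (hn : 2 ≤ n) {s : ℂ}
    (hs : 1 / (n : ℝ) < s.re) :
    Summable (solomonTerm s :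
      FiniteIndexSublattice ℤ[Equiv.Perm (Fin (n + 1))] V → ℂ) ∧
    solomonZeta ℤ[Equiv.Perm (Fin (n + 1))] V s =
      riemannZeta (n * s) * ∑ d ∈ (n + 1).divisors, (d : ℂ) ^ (-s) := by
  have hre : 1 < (n * s).re := by
    have hn0 : (0 : ℝ) < n := by exact_mod_cast (by omega : 0 < n)
    simpa [mul_comm] using (div_lt_iff₀ hn0).1 hs
  have h1 : Summable fun k : ℕ => ‖1 / ((k : ℂ) + 1) ^ (n * s)‖ := by
    have := (summable_nat_add_iff 1).2 (Complex.summable_one_div_nat_cpow.2 hre)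
    exact_mod_cast this.norm
  have h2 : Summable fun d : (n + 1).divisors => ‖((d : ℕ) : ℂ) ^ (-s)‖ := Summable.of_finite
  constructor
  · rw [← (hf.finiteIndexEquiv hn).summable_iff]
    simpa only [Function.comp_def, solomonTerm_finiteIndexEquiv] using
      summable_mul_of_summable_norm h1 h2
  · rw [solomonZeta, ← (hf.finiteIndexEquiv hn).tsum_eq]
    simp only [solomonTerm_finiteIndexEquiv]
    rw [← tsum_mul_tsum_of_summable_norm h1 h2, ← zeta_eq_tsum_one_div_nat_add_one_cpow hre,
      tsum_fintype, Finset.sum_coe_sort (n + 1).divisors fun d : ℕ => (d : ℂ) ^ (-s)]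

end IsSignedSimplex

end

theorem corollary2 (n : ℕ) (hn : 2 ≤ n) (s : ℂ) (hs : 1 / (n : ℝ) < s.re) :
    Summable (solomonTerm s :
      FiniteIndexSublattice ℤ[Equiv.Perm (Fin (n + 1))] (SpechtLattice n hn) → ℂ) ∧
    solomonZeta ℤ[Equiv.Perm (Fin (n + 1))] (SpechtLattice n hn) s =
      riemannZeta (n * s) *
        ∏ p ∈ (n + 1).primeFactors,
          (((p : ℂ) ^ (-s)) ^ (padicValNat p (n + 1) + 1) - 1) / ((p : ℂ) ^ (-s) - 1) := by
  obtain ⟨S⟩ := nonempty_hook_tableau hn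
  have hs0 : 0 < s.re := lt_of_le_of_lt (by positivity) hs
  rw [← sum_divisors_cpow_neg n.succ_ne_zero hs0]
  exact (isSignedSimplex_spechtVector hn S).summable_and_solomonZeta_eq hn hs
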